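/- Let $n\ge 1$ be an integer, let $p>n$, $R>0$ and $\sigma>0$ be real numbers, and put $B_R^c=\{x\in\mathbb{R}^n:|x|>R\}$ and $\partial B_R=\{x\in\mathbb{R}^n:|x|=R\}$. Let $u\in W^{1,p}(B_R^c)$ be real-valued, with weak gradient $\nabla u$. Then $u$ has a trace on $\partial B_R$, again denoted by $u$ (the limit in $L^p(\partial B_R)$ of the boundary values of functions of class $C^1$ up to the boundary that converge to $u$ in $W^{1,p}(B_R^c)$), and $$\int_{B_R^c}|\nabla u|^p\,dx+\sigma\int_{\partial B_R}|u|^p\,d\nu\ \ge\ C(\sigma,R)\int_{B_R^c}\frac{|u|^p}{|x|^p}\,dx,\qquad C(\sigma,R)=\min\left\{\left(\frac{p-n}{p}\right)^p,\ R^p\,\sigma^{\frac{p}{p-1}}\right\},$$ where $\nu$ is the surface measure on $\partial B_R$ (the counting measure if $n=1$). -/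

import Mathlib

open MeasureTheory Filter Topology
open scoped ContDiff ENNReal

/-- `R^n` with its Euclidean norm. -/
abbrev Rn (n : ℕ) : Type := EuclideanSpace ℝ (Fin n)

/-- The exterior domain `{x : |x| > R}`, the interior of the complement of the ball of radius `R`
centred at the origin. -/
def exteriorBall (n : ℕ) (R : ℝ) : Set (Rn n) := {x | R < ‖x‖}

/-- Surface measure on the sphere of radius `R` in `R^n` (`1 ≤ n`), as a measure on `R^n` carried by
that sphere: the image of the standard surface measure of the unit sphere under `y ↦ R y`,
multiplied by `R^(n-1)`. For `n = 1` it is the counting measure on `{-R, R}`. -/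
noncomputable def surfaceMeasure (n : ℕ) (R : ℝ) : Measure (Rn n) :=
  ENNReal.ofReal (R ^ (n - 1)) •
    ((volume : Measure (Rn n)).toSphere).map
      (fun y : Metric.sphere (0 : Rn n) 1 => R • (y : Rn n))

/-- `u` belongs to the Sobolev space `W^{1,p}(Ω)` and `g` is its weak gradient: `u` and `g` are in
`L^p(Ω)`, and `∫_Ω u ∂_v φ = - ∫_Ω φ ⟨g, v⟩` for all test functions `φ ∈ C_c^∞(Ω)` and all
directions `v`. -/
structure HasSobolevGradient {n : ℕ} (Ω : Set (Rn n)) (p : ℝ≥0∞)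
    (u : Rn n → ℝ) (g : Rn n → Rn n) : Prop where
  memLp : MemLp u p (volume.restrict Ω)
  memLp_grad : MemLp g p (volume.restrict Ω)
  integral_eq : ∀ φ : Rn n → ℝ, ContDiff ℝ ∞ φ → HasCompactSupport φ → tsupport φ ⊆ Ω →
    ∀ v : Rn n, ∫ x in Ω, u x * fderiv ℝ φ x v = - ∫ x in Ω, φ x * inner ℝ (g x) v

/-- `T` is the trace, in `L^p(ν)` with `ν` the surface measure on the boundary of `Ω`, of the
Sobolev function `u ∈ W^{1,p}(Ω)` with weak gradient `g`: the `L^p(ν)`-limit of the restrictions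
to the boundary of functions that are `C^1` up to the boundary and converge to `u` in
`W^{1,p}(Ω)`. -/
def IsSobolevTrace {n : ℕ} (Ω : Set (Rn n)) (ν : Measure (Rn n)) (p : ℝ≥0∞)
    (u : Rn n → ℝ) (g : Rn n → Rn n) (T : Rn n → ℝ) : Prop :=
  MemLp T p ν ∧
  ∃ φ : ℕ → Rn n → ℝ,
    (∀ k, ContDiff ℝ 1 (φ k)) ∧
    Tendsto (fun k => eLpNorm (fun x => φ k x - u x) p (volume.restrict Ω)) atTop (𝓝 0) ∧
    Tendsto (fun k => eLpNorm (fun x => gradient (φ k) x - g x) p (volume.restrict Ω))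
      atTop (𝓝 0) ∧
    Tendsto (fun k => eLpNorm (fun x => φ k x - T x) p ν) atTop (𝓝 0)

/-- The constant `C(σ, R) = min {((p - n)/p)^p, R^p σ^(p/(p-1))}`. -/
noncomputable def hardyRobinConst (n : ℕ) (p σ R : ℝ) : ℝ :=
  min (((p - n) / p) ^ p) (R ^ p * σ ^ (p / (p - 1)))

/-! The argument is radial. On a ray, integrate the derivative of `|f|^p r^(n-p)`. Young's
inequality with parameter `t/r` bounds the term containing `f'` by `|f'|^p + (p-1) (t/r)^p |f|^p`,
up to the factor `r^(n-1)`, while differentiating the weight supplies a multiple `p - n` of the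
Hardy density. What remains dominates `t^p |f|^p / r^p` as soon as `p t ≤ p - n`. The boundary term
at the outer end has a favourable sign and is dropped, so no decay at infinity is needed; the one at
`R` is absorbed by the Robin term when `t^(p-1) ≤ σ R^(p-1)`. The largest `t` meeting both
constraints has `t^p = C(σ, R)`. This is `hardy_robin_interval`; polar coordinates and `|∂_r φ| ≤
|∇φ|` turn it into `hardy_robin_contDiff`.

The same device with the weight `2R - r` gives the trace inequality `trace_contDiff`. Density of
`C^1` functions (`HasSobolevGradient.exists_contDiff_eLpNorm_sub_le`) comes from extending by zero,
mollifying, and composing with a dilation `x ↦ t x`, `t > 1`, which moves the exterior domain away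
from the sphere, so that the mollifier never sees the jump of the extension. By the trace inequality
the boundary values of the approximants are Cauchy in `L^p(ν)`, whence a trace exists. All terms of
the Hardy inequality are continuous under the convergences in `IsSobolevTrace`, so it passes to the
limit for every trace. -/

/-! ### One-dimensional inequalities on a bounded interval. -/

/-- Young's inequality in the form used for Picone-type estimates. -/
lemma mul_abs_rpow_mul_le_rpow_add {p : ℝ} (hp : 1 < p) (a b : ℝ) {t : ℝ} (ht : 0 ≤ t) :
    |p * |a| ^ (p - 2) * a * b * t ^ (p - 1)| ≤ |b| ^ p + (p - 1) * (t ^ p * |a| ^ p) := by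
  have hp0 : 0 < p := by linarith
  have hpq : p.HolderConjugate (p / (p - 1)) := Real.HolderConjugate.conjExponent hp
  have hy := Real.young_inequality_of_nonneg (abs_nonneg b)
    (Real.rpow_nonneg (mul_nonneg ht (abs_nonneg a)) (p - 1)) hpq
  have h1 : ((t * |a|) ^ (p - 1)) ^ (p / (p - 1)) = t ^ p * |a| ^ p := by
    rw [← Real.rpow_mul (by positivity), mul_div_cancel₀ _ (by linarith),
      Real.mul_rpow ht (abs_nonneg a)]
  rw [h1] at hy
  have h2 : |p * |a| ^ (p - 2) * a * b * t ^ (p - 1)|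
      = p * (|b| * (t * |a|) ^ (p - 1)) := by
    have h3 : |a| ^ (p - 2) * |a| = |a| ^ (p - 1) := by
      -- Adding exponents needs a nonzero base; at zero both sides vanish because `p - 1 ≠ 0`.
      rcases eq_or_ne a 0 with rfl | ha
      · rw [abs_zero, mul_zero, Real.zero_rpow (by linarith)]
      · rw [← Real.rpow_add_one (abs_ne_zero.2 ha)]; ring_nf
    rw [abs_mul, abs_mul, abs_mul, abs_mul, abs_of_pos hp0,
      abs_of_nonneg (Real.rpow_nonneg (abs_nonneg a) _), abs_of_nonneg (Real.rpow_nonneg ht _),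
      Real.mul_rpow ht (abs_nonneg a), ← h3]
    ring
  rw [h2]
  have h4 : p * (|b| ^ p / p + t ^ p * |a| ^ p / (p / (p - 1)))
      = |b| ^ p + (p - 1) * (t ^ p * |a| ^ p) := by
    have : p - 1 ≠ 0 := by linarith
    field_simp
  rw [← h4]
  gcongr

/-- For `p < 2` the factor `|x| ^ (p - 2)` is singular at the origin, so continuity is read off from
the product being the derivative of the `C^1` function `|x| ^ p`. -/
lemma continuous_abs_rpow_sub_two_mul {p : ℝ} (hp : 1 < p) :
    Continuous fun x : ℝ => p * |x| ^ (p - 2) * x := by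
  have h : ContDiff ℝ 1 fun x : ℝ => |x| ^ p := by
    simpa using contDiff_norm_rpow (E := ℝ) hp
  have h' := h.continuous_deriv le_rfl
  convert h' using 2 with x
  exact (hasDerivAt_abs_rpow x hp).deriv.symm

/-- Fundamental theorem of calculus for `|f|^p w`. -/
lemma integral_deriv_abs_rpow_mul {p : ℝ} (hp : 1 < p) {f : ℝ → ℝ} (hf : ContDiff ℝ 1 f)
    {w w' : ℝ → ℝ} {a b : ℝ} (hab : a ≤ b) (hw : ∀ x ∈ Set.Icc a b, HasDerivAt w (w' x) x)
    (hw' : ContinuousOn w' (Set.Icc a b)) :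
    ∫ r in a..b, (p * |f r| ^ (p - 2) * f r * deriv f r * w r + |f r| ^ p * w' r)
      = |f b| ^ p * w b - |f a| ^ p * w a := by
  have hu : Set.uIcc a b = Set.Icc a b := Set.uIcc_of_le hab
  have hwc : ContinuousOn w (Set.Icc a b) := fun x hx => (hw x hx).continuousAt.continuousWithinAt
  refine intervalIntegral.integral_eq_sub_of_hasDerivAt
    (f := fun r => |f r| ^ p * w r) (fun x hx => ?_) ?_
  · rw [hu] at hx
    have h1 := ((hasDerivAt_abs_rpow (f x) hp).comp x
      (hf.differentiable one_ne_zero x).hasDerivAt).mul (hw x hx)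
    exact h1
  · refine ContinuousOn.intervalIntegrable ?_
    rw [hu]
    refine ContinuousOn.add (ContinuousOn.mul ?_ hwc) (ContinuousOn.mul ?_ hw')
    · exact (((continuous_abs_rpow_sub_two_mul hp).comp hf.continuous).mul
        (hf.continuous_deriv le_rfl)).continuousOn
    · exact (hf.continuous.abs.rpow_const fun _ => Or.inr (by linarith)).continuousOn

/-- One-dimensional weighted Hardy inequality with a Robin boundary term on a bounded interval. -/
lemma hardy_robin_interval {n : ℕ} (hn : 1 ≤ n) {p R M t σ : ℝ} (hp : (n : ℝ) < p) (hR : 0 < R)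
    (hM : R ≤ M) (ht : 0 < t) (htp : p * t ≤ p - n) (htσ : t ^ (p - 1) ≤ σ * R ^ (p - 1))
    {f : ℝ → ℝ} (hf : ContDiff ℝ 1 f) :
    t ^ p * ∫ r in R..M, r ^ (n - 1) * (|f r| ^ p / r ^ p) ≤
      (∫ r in R..M, r ^ (n - 1) * |deriv f r| ^ p) + σ * (R ^ (n - 1) * |f R| ^ p) := by
  have hn' : (1 : ℝ) ≤ n := by exact_mod_cast hn
  have hp1 : 1 < p := by linarith
  have hpos : ∀ r ∈ Set.Icc R M, 0 < r := fun r hr => hR.trans_le hr.1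
  have hu : Set.uIcc R M = Set.Icc R M := Set.uIcc_of_le hM
  have cpow (q : ℝ) : ContinuousOn (fun r : ℝ => r ^ q) (Set.Icc R M) := fun r hr =>
    (Real.continuousAt_rpow_const r q (Or.inl (hpos r hr).ne')).continuousWithinAt
  have cf : Continuous fun r => |f r| ^ p :=
    hf.continuous.abs.rpow_const fun _ => Or.inr (by linarith)
  have cf' : Continuous fun r => |deriv f r| ^ p :=
    (hf.continuous_deriv le_rfl).abs.rpow_const fun _ => Or.inr (by linarith)
  -- The weight is `r^(n-1) (1/r)^(p-1)`: the polar density times the power of `1/r` that Young's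
  -- inequality with parameter `t/r` produces.
  have key := integral_deriv_abs_rpow_mul hp1 hf (w := fun r => r ^ ((n : ℝ) - p))
    (w' := fun r => ((n : ℝ) - p) * r ^ ((n : ℝ) - p - 1)) hM
    (fun r hr => Real.hasDerivAt_rpow_const (Or.inl (hpos r hr).ne'))
    ((continuousOn_const).mul (cpow _))
  have i1 : IntervalIntegrable (fun r => r ^ (n - 1) * (|f r| ^ p / r ^ p)) volume R M := by
    refine ContinuousOn.intervalIntegrable ?_
    rw [hu]
    exact (continuousOn_id.pow _).mul (cf.continuousOn.div (cpow p)
      fun r hr => (Real.rpow_pos_of_pos (hpos r hr) _).ne')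
  have i2 : IntervalIntegrable (fun r => r ^ (n - 1) * |deriv f r| ^ p) volume R M := by
    refine ContinuousOn.intervalIntegrable ?_
    rw [hu]
    exact (continuousOn_id.pow _).mul cf'.continuousOn
  have i3 : IntervalIntegrable (fun r => p * |f r| ^ (p - 2) * f r * deriv f r * r ^ ((n : ℝ) - p)
      + |f r| ^ p * (((n : ℝ) - p) * r ^ ((n : ℝ) - p - 1))) volume R M := by
    refine ContinuousOn.intervalIntegrable ?_
    rw [hu]
    exact ((((continuous_abs_rpow_sub_two_mul hp1).comp hf.continuous).mul
        (hf.continuous_deriv le_rfl)).continuousOn.mul (cpow _)).add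
        (cf.continuousOn.mul (continuousOn_const.mul (cpow _)))
  -- Pointwise, Young costs `(p-1) t^p` copies of the Hardy density and the derivative of the weight
  -- returns `(p-n) t^(p-1)` of them; `p t ≤ p - n` leaves at least `t^p`.
  have hmono : ∫ r in R..M, (t ^ p * (r ^ (n - 1) * (|f r| ^ p / r ^ p))
        - r ^ (n - 1) * |deriv f r| ^ p) ≤
      ∫ r in R..M, (-t ^ (p - 1)) * (p * |f r| ^ (p - 2) * f r * deriv f r * r ^ ((n : ℝ) - p)
      + |f r| ^ p * (((n : ℝ) - p) * r ^ ((n : ℝ) - p - 1))) := by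
    refine intervalIntegral.integral_mono_on hM ((i1.const_mul _).sub i2) (i3.const_mul _) ?_
    intro r hr
    have hr0 := hpos r hr
    have hy := (abs_le.1 (mul_abs_rpow_mul_le_rpow_add hp1 (f r) (deriv f r)
      (t := t / r) (by positivity))).2
    have e1 : r ^ ((n : ℝ) - p) = r ^ (n - 1) / r ^ (p - 1) := by
      rw [← Real.rpow_natCast, ← Real.rpow_sub hr0, Nat.cast_sub hn]; congr 1; push_cast; ring
    have e2 : r ^ ((n : ℝ) - p - 1) = r ^ (n - 1) / r ^ p := by
      rw [← Real.rpow_natCast, ← Real.rpow_sub hr0, Nat.cast_sub hn]; congr 1; push_cast; ring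
    have e3 : t ^ p = t ^ (p - 1) * t := by
      rw [← Real.rpow_add_one ht.ne']; ring_nf
    rw [Real.div_rpow ht.le hr0.le, Real.div_rpow ht.le hr0.le] at hy
    rw [e1, e2]
    have hA : 0 ≤ t ^ (p - 1) * (r ^ (n - 1) * (|f r| ^ p / r ^ p)) := by positivity
    have hB := mul_le_mul_of_nonneg_left htp hA
    have hC := mul_le_mul_of_nonneg_left hy (pow_nonneg hr0.le (n - 1))
    rw [e3] at hC ⊢
    have hD : r ^ (n - 1) * (p * |f r| ^ (p - 2) * f r * deriv f r * (t ^ (p - 1) / r ^ (p - 1)))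
      = t ^ (p - 1) * (p * |f r| ^ (p - 2) * f r * deriv f r * (r ^ (n - 1) / r ^ (p - 1))) := by
      ring
    rw [hD] at hC
    have hE : r ^ (n - 1) * (|deriv f r| ^ p + (p - 1) * (t ^ (p - 1) * t / r ^ p * |f r| ^ p))
      = r ^ (n - 1) * |deriv f r| ^ p +
        (p - 1) * t * (t ^ (p - 1) * (r ^ (n - 1) * (|f r| ^ p / r ^ p))) := by ring
    rw [hE] at hC
    have hF : |f r| ^ p * (((n : ℝ) - p) * (r ^ (n - 1) / r ^ p))
      = (n - p) * (r ^ (n - 1) * (|f r| ^ p / r ^ p)) := by ring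
    rw [hF]
    linarith
  rw [intervalIntegral.integral_sub (i1.const_mul _) i2, intervalIntegral.integral_const_mul,
    intervalIntegral.integral_const_mul, key] at hmono
  have hRR : t ^ (p - 1) * R ^ ((n : ℝ) - p) ≤ σ * R ^ (n - 1) := by
    have e1 : R ^ ((n : ℝ) - p) = R ^ (n - 1) / R ^ (p - 1) := by
      rw [← Real.rpow_natCast, ← Real.rpow_sub hR, Nat.cast_sub hn]; congr 1; push_cast; ring
    rw [e1, mul_div_assoc', div_le_iff₀ (by positivity)]
    nlinarith [mul_le_mul_of_nonneg_right htσ (pow_nonneg hR.le (n - 1))]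
  -- The endpoint `M` enters with a minus sign, so only its nonnegativity is needed.
  have hMM : 0 ≤ t ^ (p - 1) * (|f M| ^ p * M ^ ((n : ℝ) - p)) := by
    have : 0 < M := hR.trans_le hM
    positivity
  have := mul_le_mul_of_nonneg_right hRR (Real.rpow_nonneg (abs_nonneg (f R)) p)
  nlinarith

/-- One-dimensional trace inequality. -/
lemma trace_interval {n : ℕ} {p R : ℝ} (hp : 1 < p) (hR : 0 < R)
    {f : ℝ → ℝ} (hf : ContDiff ℝ 1 f) :
    R ^ (n - 1) * |f R| ^ p ≤
      (∫ r in R..(2 * R), r ^ (n - 1) * |deriv f r| ^ p) +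
        (p - 1 + 1 / R) * ∫ r in R..(2 * R), r ^ (n - 1) * |f r| ^ p := by
  have hM : R ≤ 2 * R := by linarith
  have cf : Continuous fun r => |f r| ^ p :=
    hf.continuous.abs.rpow_const fun _ => Or.inr (by linarith)
  have cf' : Continuous fun r => |deriv f r| ^ p :=
    (hf.continuous_deriv le_rfl).abs.rpow_const fun _ => Or.inr (by linarith)
  -- This weight vanishes at `2 * R` and equals `R` at `R`, so only the wanted boundary value
  -- survives.
  have key := integral_deriv_abs_rpow_mul hp hf (w := fun r => 2 * R - r)
    (w' := fun _ => -1) hM (fun r _ => by simpa using (hasDerivAt_id r).const_sub (2 * R))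
    continuousOn_const
  have i1 : IntervalIntegrable (fun r => r ^ (n - 1) * |f r| ^ p) volume R (2 * R) :=
    ((continuous_id.pow _).mul cf).intervalIntegrable _ _
  have i2 : IntervalIntegrable (fun r => r ^ (n - 1) * |deriv f r| ^ p) volume R (2 * R) :=
    ((continuous_id.pow _).mul cf').intervalIntegrable _ _
  have i3 : IntervalIntegrable (fun r => p * |f r| ^ (p - 2) * f r * deriv f r * (2 * R - r)
      + |f r| ^ p * (-1)) volume R (2 * R) :=
    (((((continuous_abs_rpow_sub_two_mul hp).comp hf.continuous).mul
        (hf.continuous_deriv le_rfl)).mul (continuous_const.sub continuous_id)).add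
        (cf.mul continuous_const)).intervalIntegrable _ _
  -- Both sides carry an extra factor `R`, the value of the weight at `R`, which is cancelled at the
  -- end. The factor `R ^ (n - 1)` may be raised to `r ^ (n - 1)` because the bound it multiplies is
  -- nonnegative.
  have hmono : ∫ r in R..(2 * R), (-R ^ (n - 1)) *
        (p * |f r| ^ (p - 2) * f r * deriv f r * (2 * R - r) + |f r| ^ p * (-1)) ≤
      ∫ r in R..(2 * R), (R * (r ^ (n - 1) * |deriv f r| ^ p) +
        R * (p - 1 + 1 / R) * (r ^ (n - 1) * |f r| ^ p)) := by
    refine intervalIntegral.integral_mono_on hM (i3.const_mul _)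
      ((i2.const_mul _).add (i1.const_mul _)) ?_
    intro r hr
    have hy := (abs_le.1 (mul_abs_rpow_mul_le_rpow_add hp (f r) (deriv f r) zero_le_one)).1
    simp only [Real.one_rpow, mul_one, one_mul] at hy
    have hp1 : 0 < p - 1 := by linarith
    have hw : 0 ≤ 2 * R - r := by linarith [hr.2]
    have hw2 : 2 * R - r ≤ R := by linarith [hr.1]
    have hpw : R ^ (n - 1) ≤ r ^ (n - 1) := pow_le_pow_left₀ hR.le hr.1 _
    have hR1 : R * (p - 1 + 1 / R) = R * (p - 1) + 1 := by field_simp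
    have hZ : 0 ≤ |deriv f r| ^ p + (p - 1) * |f r| ^ p := by positivity
    have h1 : -(p * |f r| ^ (p - 2) * f r * deriv f r * (2 * R - r)) ≤
        R * (|deriv f r| ^ p + (p - 1) * |f r| ^ p) := by
      nlinarith
    have h2 : -(p * |f r| ^ (p - 2) * f r * deriv f r * (2 * R - r) + |f r| ^ p * (-1)) ≤
        R * |deriv f r| ^ p + R * (p - 1 + 1 / R) * |f r| ^ p := by
      rw [hR1]; linarith
    have hZ' : 0 ≤ R * |deriv f r| ^ p + R * (p - 1 + 1 / R) * |f r| ^ p := by positivity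
    calc _ = R ^ (n - 1) *
          -(p * |f r| ^ (p - 2) * f r * deriv f r * (2 * R - r) + |f r| ^ p * (-1)) := by ring
      _ ≤ R ^ (n - 1) * (R * |deriv f r| ^ p + R * (p - 1 + 1 / R) * |f r| ^ p) := by gcongr
      _ ≤ r ^ (n - 1) * (R * |deriv f r| ^ p + R * (p - 1 + 1 / R) * |f r| ^ p) := by gcongr
      _ = _ := by ring
  rw [intervalIntegral.integral_add (i2.const_mul _) (i1.const_mul _),
    intervalIntegral.integral_const_mul, intervalIntegral.integral_const_mul,
    intervalIntegral.integral_const_mul, key] at hmono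
  have : R * (R ^ (n - 1) * |f R| ^ p) ≤ R * ((∫ r in R..(2 * R), r ^ (n - 1) * |deriv f r| ^ p) +
        (p - 1 + 1 / R) * ∫ r in R..(2 * R), r ^ (n - 1) * |f r| ^ p) := by
    linarith
  exact le_of_mul_le_mul_left this hR

/-! ### Polar coordinates and surface measure. -/

/-- Polar coordinates on the exterior of a ball. -/
lemma lintegral_exteriorBall_eq {n : ℕ} (hn : 1 ≤ n) {R : ℝ} (hR : 0 < R) {F : Rn n → ℝ≥0∞}
    (hF : Measurable F) :
    ∫⁻ x in exteriorBall n R, F x =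
      ∫⁻ y : Metric.sphere (0 : Rn n) 1, (∫⁻ r in Set.Ioi R,
        ENNReal.ofReal (r ^ (n - 1)) * F (r • (y : Rn n))) ∂(volume : Measure (Rn n)).toSphere := by
  have : Nonempty (Fin n) := ⟨⟨0, hn⟩⟩
  have hS : MeasurableSet (exteriorBall n R) := measurableSet_lt measurable_const measurable_norm
  set G : Rn n → ℝ≥0∞ := (exteriorBall n R).indicator F with hG
  have hGm : Measurable G := hF.indicator hS
  rw [← lintegral_indicator hS]
  -- The origin, where polar coordinates degenerate, is a null set since the dimension is positive.
  have h0 : ∫⁻ x, G x = ∫⁻ x : ({0}ᶜ : Set (Rn n)), G x ∂((volume : Measure (Rn n)).comap (↑)) := by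
    rw [lintegral_subtype_comap (measurableSet_singleton _).compl, restrict_compl_singleton]
  have hmp := (volume : Measure (Rn n)).measurePreserving_homeomorphUnitSphereProd
  have h1 : ∫⁻ x : ({0}ᶜ : Set (Rn n)), G x ∂((volume : Measure (Rn n)).comap (↑)) =
      ∫⁻ z, G ((z.2 : ℝ) • (z.1 : Rn n)) ∂((volume : Measure (Rn n)).toSphere.prod
        (Measure.volumeIoiPow (Module.finrank ℝ (Rn n) - 1))) := by
    rw [← hmp.lintegral_comp_emb (Homeomorph.measurableEmbedding _)]
    refine lintegral_congr fun x => ?_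
    congr 1
    have := (homeomorphUnitSphereProd (Rn n)).symm_apply_apply x
    conv_lhs => rw [← this]
    have hx : ‖(x : Rn n)‖ ≠ 0 := norm_ne_zero_iff.2 x.2
    simp [smul_smul, hx]
  have hmeas : Measurable fun z : Metric.sphere (0 : Rn n) 1 × Set.Ioi (0 : ℝ) =>
      G ((z.2 : ℝ) • (z.1 : Rn n)) := hGm.comp (by fun_prop)
  rw [h0, h1, lintegral_prod _ hmeas.aemeasurable]
  refine lintegral_congr fun y => ?_
  have hGy : Measurable fun r : ℝ => G (r • (y : Rn n)) := hGm.comp (by fun_prop)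
  rw [Measure.volumeIoiPow, lintegral_withDensity_eq_lintegral_mul _ (by fun_prop)
    (by exact hGy.comp measurable_subtype_coe), finrank_euclideanSpace_fin]
  simp only [Pi.mul_apply]
  rw [lintegral_subtype_comap measurableSet_Ioi
    (fun r : ℝ => ENNReal.ofReal (r ^ (n - 1)) * G (r • (y : Rn n)))]
  rw [← lintegral_indicator measurableSet_Ioi, ← lintegral_indicator measurableSet_Ioi]
  refine lintegral_congr fun r => ?_
  have hy : ‖(y : Rn n)‖ = 1 := by simp
  by_cases hr : r ∈ Set.Ioi R
  · have hr0 : 0 < r := hR.trans hr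
    have : r • (y : Rn n) ∈ exteriorBall n R := by
      simp only [exteriorBall, Set.mem_ofPred_eq, norm_smul, hy, mul_one, Real.norm_eq_abs,
        abs_of_pos hr0]
      exact hr
    rw [Set.indicator_of_mem hr, Set.indicator_of_mem (show r ∈ Set.Ioi (0 : ℝ) from hr0), hG,
      Set.indicator_of_mem this]
  · rw [Set.indicator_of_notMem hr]
    by_cases hr0 : r ∈ Set.Ioi (0 : ℝ)
    · have : r • (y : Rn n) ∉ exteriorBall n R := by
        simp only [exteriorBall, Set.mem_ofPred_eq, norm_smul, hy, mul_one, Real.norm_eq_abs,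
          abs_of_pos (show 0 < r from hr0)]
        exact hr
      rw [Set.indicator_of_mem hr0, hG, Set.indicator_of_notMem this, mul_zero]
    · rw [Set.indicator_of_notMem hr0]

lemma measurable_smul_sphere (n : ℕ) (R : ℝ) :
    Measurable fun y : Metric.sphere (0 : Rn n) 1 => R • (y : Rn n) := by fun_prop

lemma lintegral_surfaceMeasure {n : ℕ} {R : ℝ} {F : Rn n → ℝ≥0∞}
    (hF : Measurable F) :
    ∫⁻ x, F x ∂(surfaceMeasure n R) = ∫⁻ y : Metric.sphere (0 : Rn n) 1,
      ENNReal.ofReal (R ^ (n - 1)) * F (R • (y : Rn n)) ∂(volume : Measure (Rn n)).toSphere := by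
  rw [surfaceMeasure, lintegral_smul_measure, lintegral_map hF (measurable_smul_sphere n R),
    lintegral_const_mul, smul_eq_mul]
  exact hF.comp (measurable_smul_sphere n R)

instance isFiniteMeasure_surfaceMeasure (n : ℕ) (R : ℝ) : IsFiniteMeasure (surfaceMeasure n R) := by
  have : IsFiniteMeasure (((volume : Measure (Rn n)).toSphere).map
      (fun y : Metric.sphere (0 : Rn n) 1 => R • (y : Rn n))) :=
    Measure.isFiniteMeasure_map _ _
  exact ⟨by
    rw [surfaceMeasure, Measure.smul_apply, smul_eq_mul]
    exact ENNReal.mul_lt_top ENNReal.ofReal_lt_top (measure_lt_top _ _)⟩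

/-! ### From bounded intervals to rays. -/

/-- Interval integral of a continuous nonnegative function as a lower Lebesgue integral. -/
lemma ofReal_intervalIntegral_eq_lintegral {F : ℝ → ℝ} {a b : ℝ} (hab : a ≤ b)
    (hc : ContinuousOn F (Set.Icc a b)) (h0 : ∀ r ∈ Set.Icc a b, 0 ≤ F r) :
    ENNReal.ofReal (∫ r in a..b, F r) = ∫⁻ r in Set.Ioc a b, ENNReal.ofReal (F r) := by
  rw [intervalIntegral.integral_of_le hab, ofReal_integral_eq_lintegral_ofReal]
  · exact (hc.integrableOn_Icc).mono_set Set.Ioc_subset_Icc_self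
  · filter_upwards [ae_restrict_mem measurableSet_Ioc] with r hr
    exact h0 r (Set.Ioc_subset_Icc_self hr)

lemma lintegral_Ioi_le_of_forall_Ioc_le {F : ℝ → ℝ≥0∞} (hF : Measurable F) {a : ℝ} {B : ℝ≥0∞}
    (h : ∀ b, a ≤ b → ∫⁻ r in Set.Ioc a b, F r ≤ B) : ∫⁻ r in Set.Ioi a, F r ≤ B := by
  have hcov : AECover (volume.restrict (Set.Ioi a)) atTop fun k : ℕ => Set.Iic (k : ℝ) :=
    aecover_Iic tendsto_natCast_atTop_atTop
  have hlim := hcov.lintegral_tendsto_of_countably_generated (f := F) hF.aemeasurable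
  refine le_of_tendsto hlim ?_
  filter_upwards [eventually_ge_atTop ⌈a⌉₊] with k hk
  rw [Measure.restrict_restrict measurableSet_Iic, Set.inter_comm, Set.Ioi_inter_Iic]
  exact h k (Nat.ceil_le.1 hk)

/-- The interval estimate has a bound independent of `M`, so `M` may tend to infinity. With values
in `ℝ≥0∞` no integrability along the ray has to be checked, and either side may be infinite. -/
lemma hardy_robin_ray {n : ℕ} (hn : 1 ≤ n) {p R t σ : ℝ} (hp : (n : ℝ) < p) (hR : 0 < R)
    (ht : 0 < t) (hσ : 0 < σ) (htp : p * t ≤ p - n) (htσ : t ^ (p - 1) ≤ σ * R ^ (p - 1))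
    {f : ℝ → ℝ} (hf : ContDiff ℝ 1 f) :
    ENNReal.ofReal (t ^ p) *
        ∫⁻ r in Set.Ioi R, ENNReal.ofReal (r ^ (n - 1)) * ENNReal.ofReal (|f r| ^ p / r ^ p) ≤
      (∫⁻ r in Set.Ioi R, ENNReal.ofReal (r ^ (n - 1)) * ENNReal.ofReal (|deriv f r| ^ p)) +
        ENNReal.ofReal σ * (ENNReal.ofReal (R ^ (n - 1)) * ENNReal.ofReal (|f R| ^ p)) := by
  have hn' : (1 : ℝ) ≤ n := by exact_mod_cast hn
  have cf : Continuous fun r => |f r| ^ p :=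
    hf.continuous.abs.rpow_const fun _ => Or.inr (by linarith)
  have cf' : Continuous fun r => |deriv f r| ^ p :=
    (hf.continuous_deriv le_rfl).abs.rpow_const fun _ => Or.inr (by linarith)
  have hm : Measurable fun r : ℝ =>
      ENNReal.ofReal (r ^ (n - 1)) * ENNReal.ofReal (|f r| ^ p / r ^ p) := by
    have := cf.measurable
    fun_prop
  rw [← lintegral_const_mul _ hm]
  refine lintegral_Ioi_le_of_forall_Ioc_le (hm.const_mul _) fun M hM => ?_
  rw [lintegral_const_mul _ hm]
  have hpos : ∀ r ∈ Set.Icc R M, 0 < r := fun r hr => hR.trans_le hr.1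
  have key := ENNReal.ofReal_le_ofReal (hardy_robin_interval hn hp hR hM ht htp htσ hf)
  have e1 := ofReal_intervalIntegral_eq_lintegral
    (F := fun r => r ^ (n - 1) * (|f r| ^ p / r ^ p)) hM
    ((continuousOn_id.pow _).mul (cf.continuousOn.div
      (fun r hr => (Real.continuousAt_rpow_const r p (Or.inl (hpos r hr).ne')).continuousWithinAt)
      fun r hr => (Real.rpow_pos_of_pos (hpos r hr) _).ne'))
    (fun r hr => by have := hpos r hr; positivity)
  have e2 := ofReal_intervalIntegral_eq_lintegral
    (F := fun r => r ^ (n - 1) * |deriv f r| ^ p) hM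
    ((continuousOn_id.pow _).mul cf'.continuousOn)
    (fun r hr => by have := hpos r hr; positivity)
  have h2 : 0 ≤ ∫ r in R..M, r ^ (n - 1) * |deriv f r| ^ p :=
    intervalIntegral.integral_nonneg hM fun r hr => by have := hpos r hr; positivity
  rw [ENNReal.ofReal_mul (by positivity), ENNReal.ofReal_add h2 (by positivity), e1, e2,
    ENNReal.ofReal_mul hσ.le, ENNReal.ofReal_mul (by positivity)] at key
  have c1 : ∀ r ∈ Set.Ioc R M, ENNReal.ofReal (r ^ (n - 1) * (|f r| ^ p / r ^ p)) =
      ENNReal.ofReal (r ^ (n - 1)) * ENNReal.ofReal (|f r| ^ p / r ^ p) := fun r hr =>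
    ENNReal.ofReal_mul (pow_nonneg (hR.trans hr.1).le _)
  have c2 : ∀ r ∈ Set.Ioc R M, ENNReal.ofReal (r ^ (n - 1) * |deriv f r| ^ p) =
      ENNReal.ofReal (r ^ (n - 1)) * ENNReal.ofReal (|deriv f r| ^ p) := fun r hr =>
    ENNReal.ofReal_mul (pow_nonneg (hR.trans hr.1).le _)
  rw [setLIntegral_congr_fun measurableSet_Ioc c1, setLIntegral_congr_fun measurableSet_Ioc c2]
    at key
  refine key.trans ?_
  gcongr
  exact Set.Ioc_subset_Ioi_self

/-- Only the piece up to `2 * R` matters; the integrals over it are then enlarged to the whole ray.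
-/
lemma trace_ray {n : ℕ} {p R : ℝ} (hp : 1 < p) (hR : 0 < R)
    {f : ℝ → ℝ} (hf : ContDiff ℝ 1 f) :
    ENNReal.ofReal (R ^ (n - 1)) * ENNReal.ofReal (|f R| ^ p) ≤
      (∫⁻ r in Set.Ioi R, ENNReal.ofReal (r ^ (n - 1)) * ENNReal.ofReal (|deriv f r| ^ p)) +
        ENNReal.ofReal (p - 1 + 1 / R) *
          ∫⁻ r in Set.Ioi R, ENNReal.ofReal (r ^ (n - 1)) * ENNReal.ofReal (|f r| ^ p) := by
  have hM : R ≤ 2 * R := by linarith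
  have cf : Continuous fun r => |f r| ^ p :=
    hf.continuous.abs.rpow_const fun _ => Or.inr (by linarith)
  have cf' : Continuous fun r => |deriv f r| ^ p :=
    (hf.continuous_deriv le_rfl).abs.rpow_const fun _ => Or.inr (by linarith)
  have hpos : ∀ r ∈ Set.Icc R (2 * R), 0 < r := fun r hr => hR.trans_le hr.1
  have key := ENNReal.ofReal_le_ofReal (trace_interval (n := n) hp hR hf)
  have e1 := ofReal_intervalIntegral_eq_lintegral
    (F := fun r => r ^ (n - 1) * |f r| ^ p) hM ((continuousOn_id.pow _).mul cf.continuousOn)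
    (fun r hr => by have := hpos r hr; positivity)
  have e2 := ofReal_intervalIntegral_eq_lintegral
    (F := fun r => r ^ (n - 1) * |deriv f r| ^ p) hM
    ((continuousOn_id.pow _).mul cf'.continuousOn)
    (fun r hr => by have := hpos r hr; positivity)
  have h1 : 0 ≤ ∫ r in R..(2 * R), r ^ (n - 1) * |f r| ^ p :=
    intervalIntegral.integral_nonneg hM fun r hr => by have := hpos r hr; positivity
  have h2 : 0 ≤ ∫ r in R..(2 * R), r ^ (n - 1) * |deriv f r| ^ p :=
    intervalIntegral.integral_nonneg hM fun r hr => by have := hpos r hr; positivity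
  have hp1 : 0 < p - 1 := by linarith
  rw [ENNReal.ofReal_mul (by positivity), ENNReal.ofReal_add h2 (by positivity),
    ENNReal.ofReal_mul (by positivity), e1, e2] at key
  have c1 : ∀ r ∈ Set.Ioc R (2 * R), ENNReal.ofReal (r ^ (n - 1) * |f r| ^ p) =
      ENNReal.ofReal (r ^ (n - 1)) * ENNReal.ofReal (|f r| ^ p) := fun r hr =>
    ENNReal.ofReal_mul (pow_nonneg (hR.trans hr.1).le _)
  have c2 : ∀ r ∈ Set.Ioc R (2 * R), ENNReal.ofReal (r ^ (n - 1) * |deriv f r| ^ p) =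
      ENNReal.ofReal (r ^ (n - 1)) * ENNReal.ofReal (|deriv f r| ^ p) := fun r hr =>
    ENNReal.ofReal_mul (pow_nonneg (hR.trans hr.1).le _)
  rw [setLIntegral_congr_fun measurableSet_Ioc c1, setLIntegral_congr_fun measurableSet_Ioc c2]
    at key
  refine key.trans ?_
  gcongr <;> exact Set.Ioc_subset_Ioi_self

/-! ### The inequalities for `C^1` functions on the exterior domain. -/

lemma contDiff_comp_ray {n : ℕ} {φ : Rn n → ℝ} (hφ : ContDiff ℝ 1 φ) (y : Rn n) :
    ContDiff ℝ 1 fun r : ℝ => φ (r • y) := hφ.comp (contDiff_id.smul contDiff_const)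

lemma abs_deriv_comp_ray_le {n : ℕ} {φ : Rn n → ℝ} (hφ : ContDiff ℝ 1 φ) {y : Rn n}
    (hy : ‖y‖ = 1) (r : ℝ) : |deriv (fun r : ℝ => φ (r • y)) r| ≤ ‖gradient φ (r • y)‖ := by
  have hd : HasFDerivAt φ (fderiv ℝ φ (r • y)) (r • y) :=
    (hφ.differentiable one_ne_zero _).hasFDerivAt
  have h1 : HasDerivAt (fun r : ℝ => φ (r • y)) (fderiv ℝ φ (r • y) y) r := by
    simpa using! hd.comp_hasDerivAt r ((hasDerivAt_id r).smul_const y)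
  rw [h1.deriv, gradient, LinearIsometryEquiv.norm_map]
  simpa [hy] using (fderiv ℝ φ (r • y)).le_opNorm y

lemma continuous_gradient {n : ℕ} {φ : Rn n → ℝ} (hφ : ContDiff ℝ 1 φ) :
    Continuous (gradient φ) :=
  (LinearIsometryEquiv.continuous _).comp (hφ.continuous_fderiv one_ne_zero)

lemma lintegral_ray_deriv_le {n : ℕ} (hn : 1 ≤ n) {p R : ℝ} (hp : 0 ≤ p) (hR : 0 < R)
    {φ : Rn n → ℝ} (hφ : ContDiff ℝ 1 φ) :
    ∫⁻ y : Metric.sphere (0 : Rn n) 1, (∫⁻ r in Set.Ioi R, ENNReal.ofReal (r ^ (n - 1)) *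
        ENNReal.ofReal (|deriv (fun r : ℝ => φ (r • (y : Rn n))) r| ^ p))
        ∂(volume : Measure (Rn n)).toSphere ≤
      ∫⁻ x in exteriorBall n R, ENNReal.ofReal (‖gradient φ x‖ ^ p) := by
  have cg : Measurable (gradient φ) := (continuous_gradient hφ).measurable
  rw [lintegral_exteriorBall_eq hn hR (by fun_prop)]
  gcongr with y r
  exact abs_deriv_comp_ray_le hφ (by simp) r

/-- The Hardy inequality with Robin boundary term for functions of class `C^1` up to the
boundary. -/
lemma hardy_robin_contDiff {n : ℕ} (hn : 1 ≤ n) {p R t σ : ℝ} (hp : (n : ℝ) < p) (hR : 0 < R)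
    (ht : 0 < t) (hσ : 0 < σ) (htp : p * t ≤ p - n) (htσ : t ^ (p - 1) ≤ σ * R ^ (p - 1))
    {φ : Rn n → ℝ} (hφ : ContDiff ℝ 1 φ) :
    ENNReal.ofReal (t ^ p) * ∫⁻ x in exteriorBall n R, ENNReal.ofReal (|φ x| ^ p / ‖x‖ ^ p) ≤
      (∫⁻ x in exteriorBall n R, ENNReal.ofReal (‖gradient φ x‖ ^ p)) +
        ENNReal.ofReal σ * ∫⁻ x, ENNReal.ofReal (|φ x| ^ p) ∂(surfaceMeasure n R) := by
  have hp0 : 0 ≤ p := (Nat.cast_nonneg n).trans hp.le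
  have cφ : Measurable φ := hφ.continuous.measurable
  have hm1 : Measurable fun y : Metric.sphere (0 : Rn n) 1 =>
      ENNReal.ofReal (R ^ (n - 1)) * ENNReal.ofReal (|φ (R • (y : Rn n))| ^ p) := by fun_prop
  have hm2 : Measurable fun y : Metric.sphere (0 : Rn n) 1 => ∫⁻ r in Set.Ioi R,
      ENNReal.ofReal (r ^ (n - 1)) *
        ENNReal.ofReal (|φ (r • (y : Rn n))| ^ p / ‖r • (y : Rn n)‖ ^ p) := by
    refine Measurable.lintegral_prod_right' (f := fun z : Metric.sphere (0 : Rn n) 1 × ℝ =>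
      ENNReal.ofReal (z.2 ^ (n - 1)) *
        ENNReal.ofReal (|φ (z.2 • (z.1 : Rn n))| ^ p / ‖z.2 • (z.1 : Rn n)‖ ^ p)) ?_
    fun_prop
  rw [lintegral_surfaceMeasure (by fun_prop), ← lintegral_const_mul _ hm1,
    lintegral_exteriorBall_eq hn hR (by fun_prop), ← lintegral_const_mul _ hm2]
  refine le_trans ?_ (add_le_add_left (lintegral_ray_deriv_le hn hp0 hR hφ) _)
  rw [← lintegral_add_right _ (hm1.const_mul _)]
  refine lintegral_mono fun y => ?_
  refine le_trans (le_of_eq ?_) (hardy_robin_ray hn hp hR ht hσ htp htσ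
    (contDiff_comp_ray hφ (y : Rn n)))
  congr 1
  refine setLIntegral_congr_fun measurableSet_Ioi fun r hr => ?_
  have hr0 : 0 < r := hR.trans hr
  simp [norm_smul, abs_of_pos hr0]

/-- The trace inequality on a sphere for functions of class `C^1` up to the boundary. -/
lemma trace_contDiff {n : ℕ} (hn : 1 ≤ n) {p R : ℝ} (hp : 1 < p) (hR : 0 < R)
    {φ : Rn n → ℝ} (hφ : ContDiff ℝ 1 φ) :
    ∫⁻ x, ENNReal.ofReal (|φ x| ^ p) ∂(surfaceMeasure n R) ≤
      (∫⁻ x in exteriorBall n R, ENNReal.ofReal (‖gradient φ x‖ ^ p)) +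
        ENNReal.ofReal (p - 1 + 1 / R) *
          ∫⁻ x in exteriorBall n R, ENNReal.ofReal (|φ x| ^ p) := by
  have cφ : Measurable φ := hφ.continuous.measurable
  have hm2 : Measurable fun y : Metric.sphere (0 : Rn n) 1 => ∫⁻ r in Set.Ioi R,
      ENNReal.ofReal (r ^ (n - 1)) * ENNReal.ofReal (|φ (r • (y : Rn n))| ^ p) := by
    refine Measurable.lintegral_prod_right' (f := fun z : Metric.sphere (0 : Rn n) 1 × ℝ =>
      ENNReal.ofReal (z.2 ^ (n - 1)) * ENNReal.ofReal (|φ (z.2 • (z.1 : Rn n))| ^ p)) ?_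
    fun_prop
  rw [lintegral_surfaceMeasure (by fun_prop),
    lintegral_exteriorBall_eq (F := fun x => ENNReal.ofReal (|φ x| ^ p)) hn hR (by fun_prop),
    ← lintegral_const_mul _ hm2]
  refine le_trans ?_ (add_le_add_left (lintegral_ray_deriv_le hn (by linarith) hR hφ) _)
  rw [← lintegral_add_right _ (hm2.const_mul _)]
  exact lintegral_mono fun y => trace_ray hp hR (contDiff_comp_ray hφ (y : Rn n))

/-! ### Dilations, translations and mollification in `L^p`. -/

section Mollification

variable {E : Type*} [NormedAddCommGroup E] [NormedSpace ℝ E] [FiniteDimensional ℝ E]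
  [MeasurableSpace E] {μ : Measure E} [μ.IsAddHaarMeasure]
  {F : Type*} [NormedAddCommGroup F]

/-- Continuity in `L^p` of dilations and translations, for continuous functions with compact
support. -/
lemma exists_eLpNorm_smul_sub_sub_le_of_hasCompactSupport {h : E → F} (hc : Continuous h)
    (hs : HasCompactSupport h) {p : ℝ≥0∞} {ε : ℝ≥0∞} (hε : ε ≠ 0) :
    ∃ δ > 0, ∀ t : ℝ, 1 ≤ t → t ≤ 1 + δ → ∀ z : E, ‖z‖ ≤ δ →
      eLpNorm (fun x => h (t • x - z) - h x) p μ ≤ ε := by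
  obtain ⟨K, hK⟩ : ∃ K : ℝ, ∀ x, K < ‖x‖ → h x = 0 := by
    obtain ⟨K, hK⟩ := hs.isBounded.subset_closedBall (0 : E)
    refine ⟨K, fun x hx => image_eq_zero_of_notMem_tsupport fun hx' => ?_⟩
    have := hK hx'
    rw [mem_closedBall_zero_iff] at this
    linarith
  wlog hK0 : 0 ≤ K generalizing K
  · exact this 0 (fun x hx => hK x (by linarith)) le_rfl
  set B : Set E := Metric.closedBall 0 (K + 1)
  have hB : μ B ^ (1 / p.toReal) ≠ (⊤ : ℝ≥0∞) :=
    ENNReal.rpow_ne_top_of_nonneg (by positivity) measure_closedBall_lt_top.ne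
  -- A uniform error `η` on the ball `B` costs at most `η μ(B)^(1/p) < ε` in `L^p`.
  obtain ⟨η, hη, hηlt⟩ := ENNReal.exists_nnreal_pos_mul_lt hB hε
  obtain ⟨δ, hδ, hu⟩ := Metric.uniformContinuous_iff.1
    (hc.uniformContinuous_of_tendsto_cocompact hs.is_zero_at_infty) η (by exact_mod_cast hη)
  -- On `B` points move by at most `(K + 2) δ / (K + 3) < δ`. Outside `B`, `‖t • x - z‖ ≥ ‖x‖ - 1 >
  -- K`, so both values of `h` vanish.
  refine ⟨min 1 (δ / (K + 3)), by positivity, fun t ht ht' z hz => ?_⟩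
  have hz1 : ‖z‖ ≤ 1 := hz.trans (min_le_left _ _)
  have hz2 : ‖z‖ ≤ δ / (K + 3) := hz.trans (min_le_right _ _)
  have ht2 : t - 1 ≤ δ / (K + 3) := by linarith [min_le_right 1 (δ / (K + 3))]
  refine le_trans (eLpNorm_mono (g := B.indicator fun _ => (η : ℝ)) fun x => ?_)
    ((eLpNorm_indicator_const_le _ _).trans ?_)
  · by_cases hx : x ∈ B
    · rw [Set.indicator_of_mem hx, ← dist_eq_norm, Real.norm_eq_abs, NNReal.abs_eq]
      refine (hu ?_).le
      have hx' : ‖x‖ ≤ K + 1 := by simpa [B] using hx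
      have : t • x - z - x = (t - 1) • x - z := by rw [sub_smul, one_smul]; abel
      rw [dist_eq_norm, this]
      calc ‖(t - 1) • x - z‖ ≤ ‖(t - 1) • x‖ + ‖z‖ := norm_sub_le _ _
        _ ≤ δ / (K + 3) * (K + 1) + δ / (K + 3) := by
          rw [norm_smul, Real.norm_of_nonneg (by linarith)]
          gcongr
        _ < δ := by
          rw [← mul_add_one, div_mul_eq_mul_div, div_lt_iff₀ (by positivity)]
          nlinarith
    · have hx' : K + 1 < ‖x‖ := by simpa [B] using hx
      have h1 : ‖x‖ - 1 ≤ ‖t • x - z‖ := by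
        have h2 : ‖x‖ ≤ ‖t • x‖ := by
          rw [norm_smul, Real.norm_of_nonneg (by linarith)]
          exact le_mul_of_one_le_left (norm_nonneg x) ht
        linarith [norm_sub_norm_le (t • x) z]
      rw [hK x (by linarith), hK (t • x - z) (by linarith), sub_zero, norm_zero]
      exact norm_nonneg _
  · have : ‖(η : ℝ)‖ₑ = η := by simp
    rw [this]
    exact hηlt.le

variable [BorelSpace E]

/-- Translations preserve `μ`, and the dilation contributes the factor `t ^ (-dim E) ≤ 1`. Hence
substituting `t • x - z` never increases an `L^p` norm, and null sets pull back to null sets. -/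
lemma map_smul_sub_le {t : ℝ} (ht : 1 ≤ t) (z : E) : μ.map (fun x => t • x - z) ≤ μ := by
  have h1 : (fun x : E => t • x - z) = (fun x => x - z) ∘ fun x => t • x := rfl
  rw [h1, ← Measure.map_map (by fun_prop) (by fun_prop),
    Measure.map_addHaar_smul μ (by positivity), Measure.map_smul, map_sub_right_eq_self]
  have hc : ENNReal.ofReal |(t ^ Module.finrank ℝ E)⁻¹| ≤ 1 := by
    rw [ENNReal.ofReal_le_one, abs_of_nonneg (by positivity)]
    exact inv_le_one_of_one_le₀ (one_le_pow₀ ht)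
  intro s
  rw [Measure.smul_apply, smul_eq_mul]
  exact mul_le_of_le_one_left zero_le hc

lemma eLpNorm_comp_smul_sub_le {f : E → F} (hf : AEStronglyMeasurable f μ) {p : ℝ≥0∞} {t : ℝ}
    (ht : 1 ≤ t) (z : E) : eLpNorm (fun x => f (t • x - z)) p μ ≤ eLpNorm f p μ := by
  have h := eLpNorm_map_measure (p := p) (hf.mono_measure (map_smul_sub_le ht z))
    (f := fun x => t • x - z) (by fun_prop)
  exact h.symm.le.trans (eLpNorm_mono_measure _ (map_smul_sub_le ht z))

lemma aestronglyMeasurable_comp_smul_sub {f : E → F} (hf : AEStronglyMeasurable f μ) {t : ℝ}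
    (ht : 1 ≤ t) (z : E) : AEStronglyMeasurable (fun x => f (t • x - z)) μ :=
  (hf.mono_measure (map_smul_sub_le ht z)).comp_aemeasurable (by fun_prop)

/-- Continuity in `L^p` of dilations and translations. -/
lemma MeasureTheory.MemLp.exists_eLpNorm_smul_sub_sub_le [NormedSpace ℝ F] {f : E → F} {p : ℝ≥0∞}
    (hf : MemLp f p μ) (hp1 : 1 ≤ p) (hp : p ≠ (⊤ : ℝ≥0∞)) {ε : ℝ≥0∞} (hε : ε ≠ 0) :
    ∃ δ > 0, ∀ t : ℝ, 1 ≤ t → t ≤ 1 + δ → ∀ z : E, ‖z‖ ≤ δ →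
      eLpNorm (fun x => f (t • x - z) - f x) p μ ≤ ε := by
  have hε3 : ε / 3 ≠ 0 := (ENNReal.div_pos hε (by simp)).ne'
  obtain ⟨h, hs, hfh, hc, hh⟩ := hf.exists_hasCompactSupport_eLpNorm_sub_le hp hε3
  obtain ⟨δ, hδ, H⟩ := exists_eLpNorm_smul_sub_sub_le_of_hasCompactSupport (μ := μ) (p := p)
    hc hs hε3
  refine ⟨δ, hδ, fun t ht ht' z hz => ?_⟩
  have hfm := hf.sub hh
  -- Three errors of size `ε / 3`: the moved remainder `f - h`, the displacement of `h`, and the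
  -- remainder itself.
  have e : (fun x => f (t • x - z) - f x) = (fun x => (f - h) (t • x - z)) +
      ((fun x => h (t • x - z) - h x) - (f - h)) := by
    ext x; simp
  have m1 := aestronglyMeasurable_comp_smul_sub hfm.1 ht z
  have m2 : AEStronglyMeasurable (fun x => h (t • x - z) - h x) μ :=
    (aestronglyMeasurable_comp_smul_sub hh.1 ht z).sub hh.1
  rw [e]
  refine (eLpNorm_add_le m1 (m2.sub hfm.1) hp1).trans ?_
  calc _ ≤ ε / 3 + (ε / 3 + ε / 3) :=
        add_le_add ((eLpNorm_comp_smul_sub_le hfm.1 ht z).trans hfh)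
          ((eLpNorm_sub_le m2 hfm.1 hp1).trans (add_le_add (H t ht ht' z hz) hfh))
    _ = ε := by rw [← add_assoc, ENNReal.add_thirds]

/-- Jensen's inequality, in the guise of monotonicity of `L^p` norms in the exponent on a
probability space. -/
lemma rpow_lintegral_le_lintegral_rpow {α : Type*} [MeasurableSpace α] {ν : Measure α}
    [IsProbabilityMeasure ν] {p : ℝ} (hp : 1 ≤ p) {f : α → ℝ≥0∞} (hf : Measurable f) :
    (∫⁻ x, f x ∂ν) ^ p ≤ ∫⁻ x, f x ^ p ∂ν := by
  have h := eLpNorm'_le_eLpNorm'_of_exponent_le zero_lt_one hp ν hf.aestronglyMeasurable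
  simp only [eLpNorm', enorm_eq_self, ENNReal.rpow_one, div_one] at h
  have h2 := ENNReal.rpow_le_rpow h (by linarith : 0 ≤ p)
  rwa [← ENNReal.rpow_mul, one_div, inv_mul_cancel₀ (by linarith), ENNReal.rpow_one] at h2

open scoped Convolution

/-- Mollification followed by a dilation is close to the identity in `L^p`. -/
lemma eLpNorm_normed_convolution_smul_sub_le [NormedSpace ℝ F] [CompleteSpace F] {f : E → F}
    (hfm : StronglyMeasurable f) {p : ℝ} (hp : 1 ≤ p) (hf : MemLp f (ENNReal.ofReal p) μ)
    (ρ : ContDiffBump (0 : E)) {t : ℝ} {ε : ℝ≥0∞}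
    (h : ∀ z : E, ‖z‖ ≤ ρ.rOut → eLpNorm (fun x => f (t • x - z) - f x) (ENNReal.ofReal p) μ ≤ ε) :
    eLpNorm (fun x => (ρ.normed μ ⋆[ContinuousLinearMap.lsmul ℝ ℝ, μ] f) (t • x) - f x)
      (ENNReal.ofReal p) μ ≤ ε := by
  have hp0 : 0 < p := by linarith
  have hq0 : ENNReal.ofReal p ≠ 0 := by simpa using hp0
  have hp1 : 1 ≤ ENNReal.ofReal p := by simpa using hp
  have htr : (ENNReal.ofReal p).toReal = p := ENNReal.toReal_ofReal hp0.le
  have hloc := hf.locallyIntegrable hp1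
  have hρm : Measurable fun z => ENNReal.ofReal (ρ.normed μ z) :=
    ρ.continuous_normed.measurable.ennreal_ofReal
  -- The mollifier as a probability measure: the error becomes a `ν`-average of displaced
  -- differences, and Jensen followed by Tonelli reduces it to the hypothesis for each fixed `z`.
  set ν : Measure E := μ.withDensity fun z => ENNReal.ofReal (ρ.normed μ z) with hν
  have hνp : IsProbabilityMeasure ν := ⟨by
    rw [hν, withDensity_apply _ MeasurableSet.univ, Measure.restrict_univ,
      ← ofReal_integral_eq_lintegral_ofReal (ρ.integrable_normed (μ := μ))
        (ae_of_all _ ρ.nonneg_normed), ρ.integral_normed (μ := μ), ENNReal.ofReal_one]⟩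
  have hHm : Measurable fun q : E × E => ‖f (t • q.1 - q.2) - f q.1‖ₑ := by
    have h1 : StronglyMeasurable fun q : E × E => f (t • q.1 - q.2) :=
      hfm.comp_measurable (by fun_prop)
    have h2 : StronglyMeasurable fun q : E × E => f q.1 := hfm.comp_measurable measurable_fst
    exact (h1.sub h2).enorm
  have hHx (x : E) : Measurable fun z => ‖f (t • x - z) - f x‖ₑ :=
    hHm.comp (measurable_prodMk_left (x := x))
  have hpt : ∀ x, ‖(ρ.normed μ ⋆[ContinuousLinearMap.lsmul ℝ ℝ, μ] f) (t • x) - f x‖ₑ ≤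
      ∫⁻ z, ‖f (t • x - z) - f x‖ₑ ∂ν := by
    intro x
    have hi : Integrable (fun z => ρ.normed μ z • f (t • x - z)) μ := by
      have := (ρ.hasCompactSupport_normed (μ := μ)).convolutionExists_left
        (ContinuousLinearMap.lsmul ℝ ℝ) ρ.continuous_normed hloc (t • x)
      exact this
    have hi2 : Integrable (fun z => ρ.normed μ z • f x) μ := ρ.integrable_normed.smul_const _
    have he : (ρ.normed μ ⋆[ContinuousLinearMap.lsmul ℝ ℝ, μ] f) (t • x) - f x =
        ∫ z, ρ.normed μ z • (f (t • x - z) - f x) ∂μ := by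
      simp_rw [smul_sub]
      rw [integral_sub hi hi2, ρ.integral_normed_smul]
      rfl
    rw [he]
    refine (enorm_integral_le_lintegral_enorm _).trans (le_of_eq ?_)
    rw [hν, lintegral_withDensity_eq_lintegral_mul _ hρm (hHx x)]
    refine lintegral_congr fun z => ?_
    rw [enorm_smul, Real.enorm_of_nonneg (ρ.nonneg_normed z)]
    rfl
  rw [eLpNorm_eq_lintegral_rpow_enorm_toReal hq0 ENNReal.ofReal_ne_top, htr, one_div,
    ENNReal.rpow_inv_le_iff hp0]
  calc ∫⁻ x, ‖(ρ.normed μ ⋆[ContinuousLinearMap.lsmul ℝ ℝ, μ] f) (t • x) - f x‖ₑ ^ p ∂μ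
      ≤ ∫⁻ x, ∫⁻ z, ‖f (t • x - z) - f x‖ₑ ^ p ∂ν ∂μ := by
        refine lintegral_mono fun x => ?_
        exact (ENNReal.rpow_le_rpow (hpt x) hp0.le).trans
          (rpow_lintegral_le_lintegral_rpow hp (hHx x))
    _ = ∫⁻ z, ∫⁻ x, ‖f (t • x - z) - f x‖ₑ ^ p ∂μ ∂ν :=
        lintegral_lintegral_swap (hHm.pow_const p).aemeasurable
    _ ≤ ∫⁻ z, ε ^ p ∂ν := by
        refine lintegral_mono_ae ?_
        -- Only those `z` with nonzero density count, and they lie within `ρ.rOut` of the origin.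
        rw [hν, ae_withDensity_iff hρm]
        refine ae_of_all _ fun z hz => ?_
        have hz' : ‖z‖ ≤ ρ.rOut := by
          have : z ∈ Function.support (ρ.normed μ) := fun h0 => hz (by simp [h0])
          rw [ρ.support_normed_eq, mem_ball_zero_iff] at this
          exact this.le
        have := h z hz'
        rwa [eLpNorm_eq_lintegral_rpow_enorm_toReal hq0 ENNReal.ofReal_ne_top, htr, one_div,
          ENNReal.rpow_inv_le_iff hp0] at this
    _ = ε ^ p := by simp

end Mollification

/-! ### Density of `C^1` functions in the Sobolev space. -/

open scoped Convolution

lemma measurableSet_exteriorBall (n : ℕ) (R : ℝ) : MeasurableSet (exteriorBall n R) :=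
  measurableSet_lt measurable_const measurable_norm

lemma HasSobolevGradient.congr_ae {n : ℕ} {Ω : Set (Rn n)} {p : ℝ≥0∞} {u u' : Rn n → ℝ}
    {g g' : Rn n → Rn n} (h : HasSobolevGradient Ω p u g) (hu : u =ᵐ[volume.restrict Ω] u')
    (hg : g =ᵐ[volume.restrict Ω] g') : HasSobolevGradient Ω p u' g' where
  memLp := h.memLp.ae_eq hu
  memLp_grad := h.memLp_grad.ae_eq hg
  integral_eq φ h1 h2 h3 v := by
    have e1 : ∫ x in Ω, u' x * fderiv ℝ φ x v = ∫ x in Ω, u x * fderiv ℝ φ x v :=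
      integral_congr_ae (by filter_upwards [hu] with x hx; rw [hx])
    have e2 : ∫ x in Ω, φ x * inner ℝ (g' x) v = ∫ x in Ω, φ x * inner ℝ (g x) v :=
      integral_congr_ae (by filter_upwards [hg] with x hx; rw [hx])
    rw [e1, e2, h.integral_eq φ h1 h2 h3 v]

/-- Away from the boundary, the mollification of a Sobolev function is differentiable and its
gradient is the mollification of the weak gradient. -/
lemma HasSobolevGradient.hasGradientAt_convolution {n : ℕ} {Ω : Set (Rn n)} (hΩ : MeasurableSet Ω)
    {p : ℝ≥0∞} (hp : 1 ≤ p) {u : Rn n → ℝ} {g : Rn n → Rn n} (h : HasSobolevGradient Ω p u g)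
    (ρ : ContDiffBump (0 : Rn n)) {x : Rn n} (hx : Metric.closedBall x ρ.rOut ⊆ Ω) :
    HasGradientAt (ρ.normed volume ⋆[ContinuousLinearMap.lsmul ℝ ℝ] Ω.indicator u)
      ((ρ.normed volume ⋆[ContinuousLinearMap.lsmul ℝ ℝ] Ω.indicator g) x) x := by
  have hu : LocallyIntegrable (Ω.indicator u) :=
    ((memLp_indicator_iff_restrict hΩ).2 h.memLp).locallyIntegrable hp
  have hg : LocallyIntegrable (Ω.indicator g) :=
    ((memLp_indicator_iff_restrict hΩ).2 h.memLp_grad).locallyIntegrable hp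
  have hc := ρ.hasCompactSupport_normed (μ := volume)
  have hs : ContDiff ℝ ∞ (ρ.normed volume) := ρ.contDiff_normed
  have hs1 : ContDiff ℝ 1 (ρ.normed volume) := ρ.contDiff_normed (n := 1)
  have hd := hc.hasFDerivAt_convolution_right (ContinuousLinearMap.lsmul ℝ ℝ) hu hs1 x
  have hcomm : (ρ.normed volume ⋆[ContinuousLinearMap.lsmul ℝ ℝ] Ω.indicator u) =
      (Ω.indicator u ⋆[ContinuousLinearMap.lsmul ℝ ℝ] ρ.normed volume) := by
    ext y
    rw [convolution_eq_swap]
    simp only [convolution_def, ContinuousLinearMap.lsmul_apply, smul_eq_mul, mul_comm]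
  rw [hcomm, hasGradientAt_iff_hasFDerivAt]
  refine hd.congr_fderiv (ContinuousLinearMap.ext fun v => ?_)
  symm
  rw [convolution_precompR_apply _ hu (hc.fderiv ℝ) (hs1.continuous_fderiv one_ne_zero),
    InnerProductSpace.toDual_apply_apply, convolution_lsmul_swap]
  have hi : Integrable (fun y => ρ.normed volume (x - y) • Ω.indicator g y) := by
    have := (hc.convolutionExists_left (ContinuousLinearMap.lsmul ℝ ℝ) ρ.continuous_normed
      hg x).integrable_swap
    exact this
  rw [real_inner_comm, ← integral_inner hi]
  -- The derivative of the convolution falls on the kernel. The reflected kernel is an admissible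
  -- test function because its support lies in the closed ball inside `Ω`; the sign from the
  -- reflection cancels the one in the weak gradient identity.
  set φ : Rn n → ℝ := fun y => ρ.normed volume (x - y) with hφ
  have hφs : ContDiff ℝ ∞ φ := hs.comp (contDiff_const.sub contDiff_id)
  have hφt : tsupport φ ⊆ Metric.closedBall x ρ.rOut := by
    refine closure_minimal (fun y hy => ?_) Metric.isClosed_closedBall
    have hy' : x - y ∈ Function.support (ρ.normed volume) := hy
    rw [ρ.support_normed_eq, mem_ball_zero_iff, ← dist_eq_norm] at hy'
    rw [Metric.mem_closedBall, dist_comm]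
    exact hy'.le
  have hφc : HasCompactSupport φ :=
    (isCompact_closedBall x ρ.rOut).of_isClosed_subset (isClosed_tsupport φ) hφt
  have hφd (y : Rn n) : fderiv ℝ φ y v = - fderiv ℝ (ρ.normed volume) (x - y) v := by
    have h1 : HasFDerivAt φ ((fderiv ℝ (ρ.normed volume) (x - y)).comp
        (-ContinuousLinearMap.id ℝ (Rn n))) y :=
      ((hs1.differentiable one_ne_zero (x - y)).hasFDerivAt).comp y
        ((hasFDerivAt_id y).const_sub x)
    rw [h1.fderiv]
    simp
  have key := h.integral_eq φ hφs hφc (hφt.trans hx) v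
  rw [convolution_def]
  have e1 : ∫ y, ContinuousLinearMap.lsmul ℝ ℝ (Ω.indicator u y)
      (fderiv ℝ (ρ.normed volume) (x - y) v) = - ∫ y in Ω, u y * fderiv ℝ φ y v := by
    rw [← integral_neg, ← integral_indicator hΩ]
    refine integral_congr_ae (ae_of_all _ fun y => ?_)
    by_cases hy : y ∈ Ω <;> simp [hy, hφd]
  have e2 : ∫ y, inner ℝ v (ρ.normed volume (x - y) • Ω.indicator g y) =
      ∫ y in Ω, φ y * inner ℝ (g y) v := by
    rw [← integral_indicator hΩ]
    refine integral_congr_ae (ae_of_all _ fun y => ?_)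
    by_cases hy : y ∈ Ω <;> simp [hy, hφ, inner_smul_right, real_inner_comm]
  rw [e1, e2, key, neg_neg]

/-- Functions of class `C^1` on the whole space are dense in the Sobolev space of the exterior of
a ball. -/
lemma HasSobolevGradient.exists_contDiff_eLpNorm_sub_le {n : ℕ} {p R : ℝ} (hp : 1 ≤ p) (hR : 0 < R)
    {u : Rn n → ℝ} {g : Rn n → Rn n}
    (h : HasSobolevGradient (exteriorBall n R) (ENNReal.ofReal p) u g) {ε : ℝ≥0∞} (hε : ε ≠ 0) :
    ∃ φ : Rn n → ℝ, ContDiff ℝ 1 φ ∧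
      eLpNorm (fun x => φ x - u x) (ENNReal.ofReal p) (volume.restrict (exteriorBall n R)) ≤ ε ∧
      eLpNorm (fun x => gradient φ x - g x) (ENNReal.ofReal p)
        (volume.restrict (exteriorBall n R)) ≤ ε := by
  -- Genuinely measurable representatives are required for the Tonelli step in the mollification
  -- estimate.
  wlog hm : StronglyMeasurable u ∧ StronglyMeasurable g generalizing u g
  · have hu := h.memLp.1.ae_eq_mk
    have hg := h.memLp_grad.1.ae_eq_mk
    obtain ⟨φ, h1, h2, h3⟩ := this (h.congr_ae hu hg)
      ⟨h.memLp.1.stronglyMeasurable_mk, h.memLp_grad.1.stronglyMeasurable_mk⟩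
    refine ⟨φ, h1, le_of_eq_of_le (eLpNorm_congr_ae ?_) h2,
      le_of_eq_of_le (eLpNorm_congr_ae ?_) h3⟩
    · filter_upwards [hu] with x hx; rw [← hx]
    · filter_upwards [hg] with x hx; rw [← hx]
  have hΩ := measurableSet_exteriorBall n R
  set Ω := exteriorBall n R with hΩd
  have hp1 : 1 ≤ ENNReal.ofReal p := by simpa using hp
  have hu := (memLp_indicator_iff_restrict hΩ).2 h.memLp
  have hg := (memLp_indicator_iff_restrict hΩ).2 h.memLp_grad
  have hε4 : ε / 4 ≠ 0 := (ENNReal.div_pos hε (by simp)).ne'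
  obtain ⟨δ₁, hδ₁, H₁⟩ := hu.exists_eLpNorm_smul_sub_sub_le hp1 ENNReal.ofReal_ne_top hε4
  obtain ⟨δ₂, hδ₂, H₂⟩ := hg.exists_eLpNorm_smul_sub_sub_le hp1 ENNReal.ofReal_ne_top hε4
  -- `η` bounds the excess `τ = t - 1` so that the term `τ • g`, created by the chain rule, stays
  -- below `ε / 4`.
  obtain ⟨η, hη, hηlt⟩ := ENNReal.exists_nnreal_pos_mul_lt hg.2.ne hε4
  set τ : ℝ := min (min 1 η) (min δ₁ δ₂) with hτ
  have hη' : (0 : ℝ) < η := by exact_mod_cast hη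
  have hτ0 : 0 < τ := by positivity
  have hτ1 : τ ≤ 1 := (min_le_left _ _).trans (min_le_left _ _)
  have hτη : τ ≤ η := (min_le_left _ _).trans (min_le_right _ _)
  have hτδ₁ : τ ≤ δ₁ := (min_le_right _ _).trans (min_le_left _ _)
  have hτδ₂ : τ ≤ δ₂ := (min_le_right _ _).trans (min_le_right _ _)
  -- The bound `r ≤ τ * R` keeps the ball of radius `r` about `t • x` inside `Ω`, since `‖t • x‖ > R
  -- + τ * R`; the bound `r ≤ τ` makes the translations as small as `δ₁` and `δ₂` demand.
  set r : ℝ := min (τ * R) τ with hr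
  have hr0 : 0 < r := by positivity
  let ρ : ContDiffBump (0 : Rn n) := ⟨r / 2, r, by positivity, by linarith⟩
  have hρ : ρ.rOut = r := rfl
  set t : ℝ := 1 + τ with ht
  have ht0 : 0 < t := by positivity
  have Au := eLpNorm_normed_convolution_smul_sub_le (hm.1.indicator hΩ) hp hu ρ (t := t)
    fun z hz => H₁ t (by linarith) (by linarith) z
      (hz.trans ((min_le_right (τ * R) τ).trans hτδ₁))
  have Ag := eLpNorm_normed_convolution_smul_sub_le (hm.2.indicator hΩ) hp hg ρ (t := t)
    fun z hz => H₂ t (by linarith) (by linarith) z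
      (hz.trans ((min_le_right (τ * R) τ).trans hτδ₂))
  set ψ := ρ.normed volume ⋆[ContinuousLinearMap.lsmul ℝ ℝ] Ω.indicator u with hψ
  set γ := ρ.normed volume ⋆[ContinuousLinearMap.lsmul ℝ ℝ] Ω.indicator g with hγ
  have hc := ρ.hasCompactSupport_normed (μ := volume)
  have hψs : ContDiff ℝ 1 ψ := hc.contDiff_convolution_left (n := 1) _ ρ.contDiff_normed
    (hu.locallyIntegrable hp1)
  have hγs : ContDiff ℝ 1 γ := hc.contDiff_convolution_left (n := 1) _ ρ.contDiff_normed
    (hg.locallyIntegrable hp1)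
  have hε4ε : ε / 4 ≤ ε := ENNReal.div_le_of_le_mul (le_mul_of_one_le_right zero_le (by norm_num))
  refine ⟨fun x => ψ (t • x), hψs.comp (contDiff_const_smul t), ?_, ?_⟩
  · refine le_trans (le_of_eq_of_le ?_ (eLpNorm_mono_measure _
      (Measure.restrict_le_self (s := Ω))))
      (Au.trans hε4ε)
    refine eLpNorm_congr_ae ?_
    filter_upwards [ae_restrict_mem hΩ] with x hx
    rw [Set.indicator_of_mem hx]
  · have hgrad : ∀ x ∈ Ω, gradient (fun x => ψ (t • x)) x = t • γ (t • x) := by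
      intro x hx
      have hx' : R < ‖x‖ := hx
      have hb : Metric.closedBall (t • x) ρ.rOut ⊆ Ω := by
        intro y hy
        rw [mem_closedBall_iff_norm, hρ] at hy
        have h1 : t * ‖x‖ - r ≤ ‖y‖ := by
          have h2 : ‖t • x‖ = t * ‖x‖ := by rw [norm_smul, Real.norm_of_nonneg ht0.le]
          linarith [norm_sub_norm_le (t • x) y, norm_sub_rev y (t • x)]
        have h3 : r ≤ τ * R := min_le_left _ _
        change R < ‖y‖
        nlinarith
      have hG := (h.hasGradientAt_convolution hΩ hp1 ρ hb)
      rw [hasGradientAt_iff_hasFDerivAt] at hG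
      have h2 : HasFDerivAt (fun x => ψ (t • x)) ((InnerProductSpace.toDual ℝ (Rn n)
          (γ (t • x))).comp (t • ContinuousLinearMap.id ℝ (Rn n))) x :=
        HasFDerivAt.comp x hG ((hasFDerivAt_id x).const_smul t)
      refine HasGradientAt.gradient ?_
      rw [hasGradientAt_iff_hasFDerivAt]
      refine h2.congr_fderiv (ContinuousLinearMap.ext fun v => ?_)
      simp
    have hgi := hg.1
    have hγm : AEStronglyMeasurable (fun x => γ (t • x)) volume :=
      (hγs.continuous.comp (continuous_const_smul t)).aestronglyMeasurable
    -- Splitting off `τ • g` leaves `t ≤ 2` times the mollification error, for a total of at most `2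
    -- (ε / 4) + ε / 4`.
    have e : (fun x => t • γ (t • x) - Ω.indicator g x) =
        t • (fun x => γ (t • x) - Ω.indicator g x) + τ • Ω.indicator g := by
      ext1 x
      simp only [Pi.add_apply, Pi.smul_apply, smul_sub, ht, add_smul, one_smul]
      abel
    calc _ = eLpNorm (fun x => t • γ (t • x) - Ω.indicator g x) (ENNReal.ofReal p)
          (volume.restrict Ω) := by
          refine eLpNorm_congr_ae ?_
          filter_upwards [ae_restrict_mem hΩ] with x hx
          rw [Set.indicator_of_mem hx, hgrad x hx]
      _ ≤ eLpNorm (fun x => t • γ (t • x) - Ω.indicator g x) (ENNReal.ofReal p) volume :=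
          eLpNorm_mono_measure _ Measure.restrict_le_self
      _ ≤ ‖t‖ₑ * (ε / 4) + ‖τ‖ₑ * eLpNorm (Ω.indicator g) (ENNReal.ofReal p) volume := by
          rw [e]
          refine (eLpNorm_add_le ((hγm.sub hgi).const_smul t) (hgi.const_smul τ) hp1).trans ?_
          rw [eLpNorm_const_smul, eLpNorm_const_smul]
          gcongr
          exact Ag
      _ ≤ 2 * (ε / 4) + ε / 4 := by
          gcongr
          · rw [Real.enorm_of_nonneg ht0.le]
            refine ENNReal.ofReal_le_of_le_toReal ?_
            rw [ENNReal.toReal_ofNat]; linarith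
          · refine le_trans ?_ hηlt.le
            gcongr
            rw [Real.enorm_of_nonneg hτ0.le, ENNReal.ofReal_le_iff_le_toReal (by simp)]
            simpa using hτη
      _ ≤ 4 * (ε / 4) := by
          rw [← add_one_mul]
          gcongr
          norm_num
      _ = ε := ENNReal.mul_div_cancel (by norm_num) (by norm_num)

/-! ### Powers and limits of `L^p` norms. -/

section Lp

variable {α : Type*} [MeasurableSpace α] {μ : Measure α} {F : Type*} [NormedAddCommGroup F]

lemma lintegral_ofReal_norm_rpow {p : ℝ} (hp : 0 < p) (f : α → F) :
    ∫⁻ x, ENNReal.ofReal (‖f x‖ ^ p) ∂μ = eLpNorm f (ENNReal.ofReal p) μ ^ p := by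
  rw [eLpNorm_eq_lintegral_rpow_enorm_toReal (by simpa using hp) ENNReal.ofReal_ne_top,
    ENNReal.toReal_ofReal hp.le, one_div, ENNReal.rpow_inv_rpow hp.ne']
  refine lintegral_congr fun x => ?_
  rw [← ENNReal.ofReal_rpow_of_nonneg (norm_nonneg _) hp.le, ofReal_norm]

/-- No integrability is needed: if the norm is infinite, both sides are zero by convention. -/
lemma integral_norm_rpow {p : ℝ} (hp : 0 < p) {f : α → F} (hf : AEStronglyMeasurable f μ) :
    ∫ x, ‖f x‖ ^ p ∂μ = (eLpNorm f (ENNReal.ofReal p) μ ^ p).toReal := by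
  rw [← lintegral_ofReal_norm_rpow hp, integral_eq_lintegral_of_nonneg_ae
    (ae_of_all _ fun x => by positivity)]
  exact (hf.norm.aemeasurable.pow_const p).aestronglyMeasurable

/-- A squeeze between the two triangle inequalities, the lower one with truncated subtraction, so
finiteness of the norms is not required. -/
lemma tendsto_eLpNorm_of_tendsto_sub {ι : Type*} {l : Filter ι} {p : ℝ≥0∞} (hp : 1 ≤ p)
    {f : ι → α → F} {f₀ : α → F} (hf : ∀ i, AEStronglyMeasurable (f i) μ)
    (hf₀ : AEStronglyMeasurable f₀ μ)
    (h : Tendsto (fun i => eLpNorm (fun x => f i x - f₀ x) p μ) l (𝓝 0)) :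
    Tendsto (fun i => eLpNorm (f i) p μ) l (𝓝 (eLpNorm f₀ p μ)) := by
  have h1 : Tendsto (fun i => eLpNorm f₀ p μ - eLpNorm (fun x => f i x - f₀ x) p μ) l
      (𝓝 (eLpNorm f₀ p μ)) := by
    simpa using ENNReal.Tendsto.sub tendsto_const_nhds h (Or.inr ENNReal.zero_ne_top)
  have h2 : Tendsto (fun i => eLpNorm f₀ p μ + eLpNorm (fun x => f i x - f₀ x) p μ) l
      (𝓝 (eLpNorm f₀ p μ)) := by
    simpa using tendsto_const_nhds.add h
  refine tendsto_of_tendsto_of_tendsto_of_le_of_le h1 h2 (fun i => ?_) fun i => ?_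
  · have := eLpNorm_sub_le (hf i) ((hf i).sub hf₀) hp
    rw [sub_sub_cancel] at this
    exact tsub_le_iff_right.2 this
  · have := eLpNorm_add_le hf₀ ((hf i).sub hf₀) hp
    rw [add_sub_cancel] at this
    exact this

end Lp

/-! ### Existence of the trace. -/

lemma memLp_surfaceMeasure_of_continuous {n : ℕ} {R : ℝ} {p : ℝ≥0∞} {φ : Rn n → ℝ}
    (hφ : Continuous φ) : MemLp φ p (surfaceMeasure n R) := by
  obtain ⟨C, hC⟩ := (isCompact_closedBall (0 : Rn n) |R|).exists_bound_of_continuousOn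
    hφ.continuousOn
  refine MemLp.of_bound hφ.aestronglyMeasurable C ?_
  rw [surfaceMeasure]
  refine Measure.ae_smul_measure ?_ _
  rw [ae_map_iff (measurable_smul_sphere n R).aemeasurable
    (measurableSet_le (by fun_prop) (by fun_prop))]
  exact ae_of_all _ fun y => hC _ (by simp [norm_smul])

lemma gradient_sub_of_contDiff {n : ℕ} {φ ψ : Rn n → ℝ} (hφ : ContDiff ℝ 1 φ)
    (hψ : ContDiff ℝ 1 ψ) (x : Rn n) :
    gradient (fun x => φ x - ψ x) x = gradient φ x - gradient ψ x := by
  simp only [gradient]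
  rw [fderiv_fun_sub (hφ.differentiable one_ne_zero x) (hψ.differentiable one_ne_zero x), map_sub]

/-- Every Sobolev function on the exterior of a ball has a trace on the sphere. -/
lemma HasSobolevGradient.exists_isSobolevTrace {n : ℕ} (hn : 1 ≤ n) {p R : ℝ} (hp : 1 < p)
    (hR : 0 < R) {u : Rn n → ℝ} {g : Rn n → Rn n}
    (h : HasSobolevGradient (exteriorBall n R) (ENNReal.ofReal p) u g) :
    ∃ T : Rn n → ℝ,
      IsSobolevTrace (exteriorBall n R) (surfaceMeasure n R) (ENNReal.ofReal p) u g T := by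
  have hp0 : 0 < p := by linarith
  have hp1 : 1 ≤ ENNReal.ofReal p := by simpa using hp.le
  have : Fact (1 ≤ ENNReal.ofReal p) := ⟨hp1⟩
  obtain ⟨ε, -, hε0, hε⟩ := exists_seq_strictAnti_tendsto' (zero_lt_one (α := ℝ≥0∞))
  choose φ hφ hφu hφg using fun k => h.exists_contDiff_eLpNorm_sub_le hp.le hR (hε0 k).1.ne'
  set Ω := exteriorBall n R
  set ν := surfaceMeasure n R
  set K := ENNReal.ofReal (p - 1 + 1 / R)
  have hL (k : ℕ) : MemLp (φ k) (ENNReal.ofReal p) ν :=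
    memLp_surfaceMeasure_of_continuous (hφ k).continuous
  -- The trace inequality for `φ k - φ l` turns closeness to `u` and `g` on `Ω` into closeness on
  -- the sphere.
  have bound (k l : ℕ) : eLpNorm (φ k - φ l) (ENNReal.ofReal p) ν ^ p ≤
      (ε k + ε l) ^ p + K * (ε k + ε l) ^ p := by
    have ht := trace_contDiff hn hp hR ((hφ k).sub (hφ l))
    simp only [← Real.norm_eq_abs] at ht
    rw [lintegral_ofReal_norm_rpow hp0, lintegral_ofReal_norm_rpow hp0,
      lintegral_ofReal_norm_rpow hp0] at ht
    refine ht.trans ?_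
    gcongr
    · have m (k : ℕ) : AEStronglyMeasurable (fun x => gradient (φ k) x - g x)
          (volume.restrict Ω) :=
        (continuous_gradient (hφ k)).aestronglyMeasurable.sub h.memLp_grad.1
      have e : gradient (fun x => φ k x - φ l x) =
          (fun x => gradient (φ k) x - g x) - fun x => gradient (φ l) x - g x := by
        ext1 x
        simp [gradient_sub_of_contDiff (hφ k) (hφ l)]
      rw [e]
      exact (eLpNorm_sub_le (m k) (m l) hp1).trans (add_le_add (hφg k) (hφg l))
    · have m (k : ℕ) : AEStronglyMeasurable (fun x => φ k x - u x) (volume.restrict Ω) :=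
        (hφ k).continuous.aestronglyMeasurable.sub h.memLp.1
      have e : (fun x => φ k x - φ l x) = (fun x => φ k x - u x) - fun x => φ l x - u x := by
        ext1 x
        simp
      rw [e]
      exact (eLpNorm_sub_le (m k) (m l) hp1).trans (add_le_add (hφu k) (hφu l))
  have hb : Tendsto (fun q : ℕ × ℕ => (ε q.1 + ε q.2) ^ p + K * (ε q.1 + ε q.2) ^ p)
      (atTop ×ˢ atTop) (𝓝 0) := by
    have h1 : Tendsto (fun q : ℕ × ℕ => ε q.1 + ε q.2) (atTop ×ˢ atTop) (𝓝 0) := by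
      simpa using (hε.comp tendsto_fst).add (hε.comp tendsto_snd)
    have h2 : Tendsto (fun q : ℕ × ℕ => (ε q.1 + ε q.2) ^ p) (atTop ×ˢ atTop) (𝓝 0) := by
      simpa [hp0] using h1.ennrpow_const p
    simpa using h2.add (ENNReal.Tendsto.const_mul h2 (Or.inr ENNReal.ofReal_ne_top))
  have hcauchy : CauchySeq fun k => (hL k).toLp (φ k) := by
    rw [EMetric.cauchySeq_iff]
    intro δ hδ
    have hδp : 0 < δ ^ p := ENNReal.rpow_pos_of_nonneg hδ hp0.le
    rw [prod_atTop_atTop_eq] at hb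
    obtain ⟨⟨a, b⟩, hab⟩ := eventually_atTop.1 (hb.eventually_lt_const hδp)
    refine ⟨max a b, fun k hk l hl => ?_⟩
    rw [Lp.edist_toLp_toLp]
    have := (bound k l).trans_lt
      (hab (k, l) ⟨(le_max_left a b).trans hk, (le_max_right a b).trans hl⟩)
    exact (ENNReal.rpow_lt_rpow_iff hp0).1 this
  obtain ⟨T, hT⟩ := cauchySeq_tendsto_of_complete hcauchy
  refine ⟨T, Lp.memLp T, φ, hφ,
    tendsto_of_tendsto_of_tendsto_of_le_of_le tendsto_const_nhds hε (fun _ => zero_le) hφu,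
    tendsto_of_tendsto_of_tendsto_of_le_of_le tendsto_const_nhds hε (fun _ => zero_le) hφg, ?_⟩
  rw [← Lp.toLp_coeFn T (Lp.memLp T)] at hT
  exact (Lp.tendsto_Lp_iff_tendsto_eLpNorm'' φ hL T (Lp.memLp T)).1 hT

/-! ### Passage to Sobolev functions and choice of the constant. -/

/-- The Hardy inequality with Robin boundary term for a Sobolev function and its trace. -/
lemma IsSobolevTrace.hardy_robin {n : ℕ} (hn : 1 ≤ n) {p R t σ : ℝ} (hp : (n : ℝ) < p)
    (hR : 0 < R) (ht : 0 < t) (hσ : 0 < σ) (htp : p * t ≤ p - n)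
    (htσ : t ^ (p - 1) ≤ σ * R ^ (p - 1)) {u T : Rn n → ℝ} {g : Rn n → Rn n}
    (hu : HasSobolevGradient (exteriorBall n R) (ENNReal.ofReal p) u g)
    (hT : IsSobolevTrace (exteriorBall n R) (surfaceMeasure n R) (ENNReal.ofReal p) u g T) :
    t ^ p * ∫ x in exteriorBall n R, |u x| ^ p / ‖x‖ ^ p ≤
      (∫ x in exteriorBall n R, ‖g x‖ ^ p) + σ * ∫ x, |T x| ^ p ∂(surfaceMeasure n R) := by
  have hn' : (1 : ℝ) ≤ n := by exact_mod_cast hn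
  have hp0 : 0 < p := by linarith
  have hp1 : 1 ≤ ENNReal.ofReal p := by
    rw [ENNReal.one_le_ofReal]; linarith
  obtain ⟨hTL, φ, hφ, hφu, hφg, hφT⟩ := hT
  set Ω := exteriorBall n R
  set ν := surfaceMeasure n R
  set q := ENNReal.ofReal p
  have hdiv (f : Rn n → ℝ) (x : Rn n) : |f x| ^ p / ‖x‖ ^ p = ‖f x / ‖x‖‖ ^ p := by
    rw [norm_div, norm_norm, Real.norm_eq_abs, Real.div_rpow (abs_nonneg _) (norm_nonneg _)]
  -- The weight `1 / ‖x‖` is at most `1 / R` on `Ω`, so the Hardy term is continuous in `L^p(Ω)`.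
  have hle (f : Rn n → ℝ) : eLpNorm (fun x => f x / ‖x‖) q (volume.restrict Ω) ≤
      ENNReal.ofReal R⁻¹ * eLpNorm f q (volume.restrict Ω) := by
    refine eLpNorm_le_mul_eLpNorm_of_ae_le_mul ?_ q
    filter_upwards [ae_restrict_mem (measurableSet_exteriorBall n R)] with x hx
    have hx' : R < ‖x‖ := hx
    rw [norm_div, norm_norm, div_eq_inv_mul]
    gcongr
  have hmn : AEStronglyMeasurable (fun x : Rn n => ‖x‖) (volume.restrict Ω) :=
    continuous_norm.aestronglyMeasurable
  have hmu : AEStronglyMeasurable (fun x => u x / ‖x‖) (volume.restrict Ω) := hu.memLp.1.div₀ hmn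
  have l1 : Tendsto (fun k => eLpNorm (fun x => φ k x / ‖x‖) q (volume.restrict Ω)) atTop
      (𝓝 (eLpNorm (fun x => u x / ‖x‖) q (volume.restrict Ω))) := by
    refine tendsto_eLpNorm_of_tendsto_sub hp1
      (fun k => (hφ k).continuous.aestronglyMeasurable.div₀ hmn) hmu ?_
    have h0 : Tendsto (fun k => ENNReal.ofReal R⁻¹ *
        eLpNorm (fun x => φ k x - u x) q (volume.restrict Ω)) atTop (𝓝 0) := by
      simpa using ENNReal.Tendsto.const_mul hφu (Or.inr ENNReal.ofReal_ne_top)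
    refine tendsto_of_tendsto_of_tendsto_of_le_of_le tendsto_const_nhds h0 (fun _ => zero_le)
      fun k => ?_
    simpa only [sub_div] using hle fun x => φ k x - u x
  have l2 := tendsto_eLpNorm_of_tendsto_sub hp1
    (fun k => (continuous_gradient (hφ k)).aestronglyMeasurable) hu.memLp_grad.1 hφg
  have l3 := tendsto_eLpNorm_of_tendsto_sub hp1
    (fun k => (hφ k).continuous.aestronglyMeasurable) hTL.1 hφT
  have key (k : ℕ) : ENNReal.ofReal (t ^ p) *
        eLpNorm (fun x => φ k x / ‖x‖) q (volume.restrict Ω) ^ p ≤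
      eLpNorm (gradient (φ k)) q (volume.restrict Ω) ^ p +
        ENNReal.ofReal σ * eLpNorm (φ k) q ν ^ p := by
    have := hardy_robin_contDiff hn hp hR ht hσ htp htσ (hφ k)
    simp only [hdiv] at this
    simp only [← Real.norm_eq_abs] at this
    rwa [lintegral_ofReal_norm_rpow hp0, lintegral_ofReal_norm_rpow hp0,
      lintegral_ofReal_norm_rpow hp0] at this
  have lim : ENNReal.ofReal (t ^ p) *
        eLpNorm (fun x => u x / ‖x‖) q (volume.restrict Ω) ^ p ≤
      eLpNorm g q (volume.restrict Ω) ^ p + ENNReal.ofReal σ * eLpNorm T q ν ^ p :=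
    le_of_tendsto_of_tendsto'
      (ENNReal.Tendsto.const_mul (l1.ennrpow_const p) (Or.inr ENNReal.ofReal_ne_top))
      ((l2.ennrpow_const p).add
        (ENNReal.Tendsto.const_mul (l3.ennrpow_const p) (Or.inr ENNReal.ofReal_ne_top))) key
  -- Finiteness of the right side suffices to return to real integrals; that of the left side
  -- follows from `lim`.
  have f2 : eLpNorm g q (volume.restrict Ω) ^ p ≠ (⊤ : ℝ≥0∞) :=
    ENNReal.rpow_ne_top_of_nonneg hp0.le hu.memLp_grad.2.ne
  have f3 : ENNReal.ofReal σ * eLpNorm T q ν ^ p ≠ (⊤ : ℝ≥0∞) :=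
    ENNReal.mul_ne_top ENNReal.ofReal_ne_top (ENNReal.rpow_ne_top_of_nonneg hp0.le hTL.2.ne)
  have fin := ENNReal.toReal_mono (ENNReal.add_ne_top.2 ⟨f2, f3⟩) lim
  rw [ENNReal.toReal_add f2 f3, ENNReal.toReal_mul, ENNReal.toReal_mul,
    ENNReal.toReal_ofReal (by positivity), ENNReal.toReal_ofReal hσ.le,
    ← integral_norm_rpow hp0 hmu, ← integral_norm_rpow hp0 hu.memLp_grad.1,
    ← integral_norm_rpow hp0 hTL.1] at fin
  simp only [hdiv]
  simpa only [← Real.norm_eq_abs] using fin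

theorem theorem6p2 (n : ℕ) (hn : 1 ≤ n) (p : ℝ) (hp : (n : ℝ) < p)
    (R : ℝ) (hR : 0 < R) (σ : ℝ) (hσ : 0 < σ)
    (u : Rn n → ℝ) (g : Rn n → Rn n)
    (hu : HasSobolevGradient (exteriorBall n R) (ENNReal.ofReal p) u g) :
    (∃ T : Rn n → ℝ,
      IsSobolevTrace (exteriorBall n R) (surfaceMeasure n R) (ENNReal.ofReal p) u g T) ∧
    ∀ T : Rn n → ℝ,
      IsSobolevTrace (exteriorBall n R) (surfaceMeasure n R) (ENNReal.ofReal p) u g T →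
      hardyRobinConst n p σ R * ∫ x in exteriorBall n R, |u x| ^ p / ‖x‖ ^ p ≤
        (∫ x in exteriorBall n R, ‖g x‖ ^ p) + σ * ∫ x, |T x| ^ p ∂(surfaceMeasure n R) := by
  have hn' : (1 : ℝ) ≤ n := by exact_mod_cast hn
  have hp1 : 1 < p := by linarith
  have hp0 : 0 < p := by linarith
  have hp1' : 0 < p - 1 := by linarith
  refine ⟨hu.exists_isSobolevTrace hn hp1 hR, fun T hT => ?_⟩
  -- `a` and `b` are the largest `t` allowed by the interior and the boundary constraint
  -- respectively; the inequality is applied with `t = min a b`.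
  set a : ℝ := (p - n) / p
  set b : ℝ := R * σ ^ (1 / (p - 1))
  have ha : 0 < a := div_pos (by linarith) hp0
  have hb : 0 < b := by positivity
  have hbp : b ^ p = R ^ p * σ ^ (p / (p - 1)) := by
    rw [Real.mul_rpow hR.le (by positivity), ← Real.rpow_mul hσ.le, one_div_mul_eq_div]
  have hbp1 : b ^ (p - 1) = σ * R ^ (p - 1) := by
    rw [Real.mul_rpow hR.le (by positivity), ← Real.rpow_mul hσ.le, one_div_mul_cancel hp1'.ne',
      Real.rpow_one, mul_comm]
  have hC : hardyRobinConst n p σ R ≤ min a b ^ p := by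
    rw [hardyRobinConst, ← hbp]
    rcases min_cases a b with ⟨h, -⟩ | ⟨h, -⟩ <;> rw [h]
    · exact min_le_left _ _
    · exact min_le_right _ _
  refine le_trans (mul_le_mul_of_nonneg_right hC (integral_nonneg fun x => by positivity))
    (hT.hardy_robin hn hp hR (lt_min ha hb) hσ ?_ ?_ hu)
  · have : p * a = p - n := mul_div_cancel₀ _ hp0.ne'
    rw [← this]
    gcongr
    exact min_le_left _ _
  · rw [← hbp1]
    exact Real.rpow_le_rpow (lt_min ha hb).le (min_le_right _ _) hp1'.le
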